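/- Let $A$ be a Borel space, i.e. a measurable space isomorphic to a Borel subset of $[0,1]$; write $\mathcal{M}_1(S)$ for the set of probability measures on a measurable space $S$, with the $\sigma$-field generated by the evaluations $P\mapsto P(B)$, $B\subseteq S$ measurable. For a word $\mathbf{w}=(w_1,\dots,w_n)\in A^n$ and $1\le k\le n$ let $$\mathrm{RSS}(\mathbf{w},k)=\binom{n}{k}^{-1}\sum_{1\le j_1<\dots<j_k\le n}\delta_{(w_{j_1},\dots,w_{j_k})}\in\mathcal{M}_1(A^k)$$ be the law of a uniformly random subsequence of length $k$ of $\mathbf{w}$. Let $$\mathcal{C}(A)=\{\rho\in\mathcal{M}_1(A\times\mathbb{R}):\ \rho(A\times[0,t])=t\ \text{for all } t\in[0,1]\},$$ with the $\sigma$-field inherited from $\mathcal{M}_1(A\times\mathbb{R})$. For $\rho\in\mathcal{C}(A)$ and $k\ge1$ let $\mathrm{SPREAD}(\rho,k)\in\mathcal{M}_1(A^k)$ be the law of $(Y_{\pi(1)},\dots,Y_{\pi(k)})$, where $(Y_1,X_1),\dots,(Y_k,X_k)$ are i.i.d. with law $\rho$ and $\pi$ is the permutation of $\{1,\dots,k\}$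 with $X_{\pi(1)}\le\dots\le X_{\pi(k)}$, ties being broken by the smaller index first. A sequence $\boldsymbol{\mu}=(\mu_k)_{k\ge1}$ with $\mu_k\in\mathcal{M}_1(A^k)$ for each $k$ satisfies $$\mu_k=\int_{A^n}\mathrm{RSS}(\mathbf{w},k)\,d\mu_n(\mathbf{w})\qquad\text{for all } 1\le k\le n\tag{1}$$ if and only if there exists a probability measure $\alpha\in\mathcal{M}_1(\mathcal{C}(A))$ such that $$\mu_k=\int_{\mathcal{C}(A)}\mathrm{SPREAD}(\rho,k)\,d\alpha(\rho)\qquad\text{for all } k\ge1.\tag{2}$$ Moreover, (2) establishes a one-to-one correspondence between $\mathcal{M}_1(\mathcal{C}(A))$ and the sequences $\boldsymbol{\mu}$ satisfying (1): the map $\alpha\mapsto\big(\int_{\mathcal{C}(A)}\mathrm{SPREAD}(\rho,k)\,d\alpha(\rho)\big)_{k\ge1}$ is a bijection between these two sets. -/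

import Mathlib

open MeasureTheory
open scoped ENNReal

noncomputable section

namespace RandomSubsequence

/-- Words of length `n` over the alphabet `A`, with the product σ-field. -/
abbrev Word (A : Type*) (n : ℕ) : Type _ := Fin n → A

/-- The induced order statistics of `y₁, …, yₙ` with respect to the real numbers `x₁, …, xₙ`: the
word `(y_{π(1)}, …, y_{π(n)})`, where `π = Tuple.sort x` is the unique permutation that arranges the
`x`-values increasingly and is stable (ties are broken by the smaller index). -/
def ios {A : Type*} {n : ℕ} (y : Fin n → A) (x : Fin n → ℝ) : Word A n :=
  fun i => y (Tuple.sort x i)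

variable {A : Type*} [MeasurableSpace A]

theorem measurableSet_sort_eq {n : ℕ} (σ : Equiv.Perm (Fin n)) :
    MeasurableSet {x : Fin n → ℝ | Tuple.sort x = σ} := by
  have h : {x : Fin n → ℝ | Tuple.sort x = σ} =
      (⋂ (i : Fin n) (j : Fin n) (_ : i ≤ j), {x | x (σ i) ≤ x (σ j)}) ∩
        ⋂ (i : Fin n) (j : Fin n) (_ : i < j) (_ : ¬ σ i < σ j), {x | x (σ i) = x (σ j)}ᶜ := by
    ext x
    simp only [Set.mem_ofPred_eq, Set.mem_inter_iff, Set.mem_iInter, Set.mem_compl_iff]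
    rw [eq_comm, Tuple.eq_sort_iff]
    refine and_congr Iff.rfl ?_
    exact forall_congr' fun i => forall_congr' fun j => forall_congr' fun _ => not_imp_not.symm
  rw [h]
  refine MeasurableSet.inter ?_ ?_
  · exact MeasurableSet.iInter fun i => MeasurableSet.iInter fun j => MeasurableSet.iInter fun _ =>
      measurableSet_le (measurable_pi_apply _) (measurable_pi_apply _)
  · exact MeasurableSet.iInter fun i => MeasurableSet.iInter fun j => MeasurableSet.iInter fun _ =>
      MeasurableSet.iInter fun _ =>
        (measurableSet_eq_fun (measurable_pi_apply (σ i)) (measurable_pi_apply (σ j))).compl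

theorem measurable_ios (n : ℕ) :
    Measurable (fun p : Fin n → A × ℝ => ios (fun i => (p i).1) (fun i => (p i).2)) := by
  refine measurable_pi_lambda _ fun i => ?_
  let _ : MeasurableSpace (Equiv.Perm (Fin n)) := ⊤
  have hs : Measurable (fun p : Fin n → A × ℝ => Tuple.sort (fun i => (p i).2)) := by
    refine measurable_to_countable' fun σ => ?_
    have hm : Measurable (fun p : Fin n → A × ℝ => fun i => (p i).2) := by fun_prop
    exact hm (measurableSet_sort_eq σ)
  have he : Measurable (fun q : (Fin n → A × ℝ) × Equiv.Perm (Fin n) => (q.1 (q.2 i)).1) :=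
    measurable_from_prod_countable_left fun σ => (measurable_pi_apply (σ i)).fst
  exact he.comp (measurable_id.prodMk hs)

/-- `RSS(w, k)`: the law of a uniformly chosen subsequence of length `k` of the word `w` of length
`n` (used for `k ≤ n` only). The sum runs over all index choices `j₁ < ⋯ < j_k`, that is, over the
strictly increasing maps `Fin k ↪o Fin n`. -/
def rss {n : ℕ} (w : Word A n) (k : ℕ) : Measure (Word A k) :=
  ((n.choose k : ℕ) : ℝ≥0∞)⁻¹ • ∑ j : Fin k ↪o Fin n, Measure.dirac (fun i => w (j i))

theorem measurable_rss (n k : ℕ) : Measurable (fun w : Word A n => rss w k) := by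
  refine Measure.measurable_of_measurable_coe _ fun s hs => ?_
  simp only [rss, Measure.smul_apply, Measure.finsetSum_apply, smul_eq_mul]
  refine Measurable.const_mul (Finset.measurable_sum _ fun j _ => ?_) _
  exact (Measure.measurable_coe hs).comp (Measure.measurable_dirac.comp (by fun_prop))

theorem bind_rss_apply {n : ℕ} (μ : Measure (Word A n)) (k : ℕ) {B : Set (Word A k)}
    (hB : MeasurableSet B) :
    μ.bind (fun w => rss w k) B = ∫⁻ w, rss w k B ∂μ :=
  Measure.bind_apply hB (measurable_rss n k).aemeasurable

/-- The sequence `μ = (μ_k)_{k ≥ 1}` of laws on words is consistent under the random-subsequence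
kernels: `μ_k = ∫ RSS(w, k) dμ_n(w)` for all `1 ≤ k ≤ n`. -/
def IsConsistent (μ : (k : ℕ+) → ProbabilityMeasure (Word A k)) : Prop :=
  ∀ k n : ℕ+, k ≤ n →
    (μ k : Measure (Word A k)) = (μ n : Measure (Word A n)).bind (fun w => rss w k)

variable (A) in
/-- `C(A)`: the probability measures `ρ` on `A × ℝ` with `ρ(A × [0,t]) = t` for all `t ∈ [0,1]`. As
a subtype of `ProbabilityMeasure (A × ℝ)` it carries the σ-field generated by the evaluations
`ρ ↦ ρ(B)`. -/
def C : Set (ProbabilityMeasure (A × ℝ)) :=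
  {ρ | ∀ t ∈ Set.Icc (0 : ℝ) 1,
    (ρ : Measure (A × ℝ)) (Set.univ ×ˢ Set.Icc 0 t) = ENNReal.ofReal t}

/-- `SPREAD(ρ, k)`: the law of the induced order statistics of `Y₁, …, Y_k` with respect to
`X₁, …, X_k`, where `(Y₁, X₁), …, (Y_k, X_k)` are i.i.d. with law `ρ`. -/
def spread (ρ : ProbabilityMeasure (A × ℝ)) (k : ℕ) : ProbabilityMeasure (Word A k) :=
  ⟨(Measure.pi (fun _ : Fin k => (ρ : Measure (A × ℝ)))).map
      (fun p => ios (fun i => (p i).1) (fun i => (p i).2)),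
    Measure.isProbabilityMeasure_map (measurable_ios k).aemeasurable⟩

theorem measurable_spread (k : ℕ) :
    Measurable (fun ρ : ProbabilityMeasure (A × ℝ) => (spread ρ k : Measure (Word A k))) := by
  refine (Measure.measurable_map _ (measurable_ios k)).comp
    (Measurable.measure_of_isPiSystem_of_isProbabilityMeasure generateFrom_pi.symm isPiSystem_pi ?_)
  rintro _ ⟨s, hs, rfl⟩
  simp only [Measure.pi_pi]
  exact Finset.measurable_prod _ fun i _ =>
    (Measure.measurable_coe (show MeasurableSet (s i) from hs i (Set.mem_univ i))).comp measurable_subtype_coe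

theorem isProbabilityMeasure_spreadMixture (α : ProbabilityMeasure (C A)) (k : ℕ) :
    IsProbabilityMeasure ((α : Measure (C A)).bind
      (fun ρ => (spread (ρ : ProbabilityMeasure (A × ℝ)) k : Measure (Word A k)))) := by
  refine isProbabilityMeasure_bind
    ((measurable_spread k).comp measurable_subtype_coe).aemeasurable ?_
  exact Filter.Eventually.of_forall fun ρ => (spread _ k).2

/-- `∫_{C(A)} SPREAD(ρ, k) dα(ρ)`, a probability measure on `A^k`; its value at a measurable `B` is
`∫ SPREAD(ρ, k)(B) dα(ρ)`. -/
def spreadMixture (α : ProbabilityMeasure (C A)) (k : ℕ) : ProbabilityMeasure (Word A k) :=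
  ⟨(α : Measure (C A)).bind
      (fun ρ => (spread (ρ : ProbabilityMeasure (A × ℝ)) k : Measure (Word A k))),
    isProbabilityMeasure_spreadMixture α k⟩

theorem spreadMixture_apply (α : ProbabilityMeasure (C A)) (k : ℕ) {B : Set (Word A k)}
    (hB : MeasurableSet B) :
    (spreadMixture α k : Measure (Word A k)) B =
      ∫⁻ ρ : C A, (spread (ρ : ProbabilityMeasure (A × ℝ)) k : Measure (Word A k)) B
        ∂(α : Measure (C A)) :=
  Measure.bind_apply hB ((measurable_spread k).comp measurable_subtype_coe).aemeasurable

end RandomSubsequence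

end

/-! A random word is treated like a sample sorted by independent uniform labels. Since `ρ` in `C A`
has uniform second marginal, the labels are almost surely distinct. A random subword of a sorted
sample is then a sorted random subsample (`sum_ios_comp`), and a subsample is again i.i.d.; this
gives the consistency of mixtures (`spread_eq_bind_rss`).

Both other claims depend only on the σ-field of `A`, so `A` may carry a compact metrizable topology
with that Borel σ-field. Then `C A` is compact and metrizable in the weak topology, its evaluation
σ-field is Borel, and `spread` is continuous because sorting is continuous at samples with distinct
labels.

Existence: a word of length `n + 1` yields the measure `wordLaw w` in `C A`, which attaches the
letters to consecutive intervals of length `1 / (n + 1)`. Sampling `k` points from it gives a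
uniform subword of `w`, except when two points share an interval, so `spread (wordLaw w) k`
dominates `rss w k` up to a factor tending to 1 (`mul_rss_le_spread_wordLaw`). Any limit point of
the laws of `wordLaw w`, with `w` distributed as `μ (n + 1)`, represents `μ`.

Uniqueness: the ranking permutation of a sample is uniform and independent of the sorted word, so
the mixture determines the `α`-mean of `ρ ↦ E h` for every order-invariant `h`
(`OrderInvariant.lintegral_mixture`). These functions are closed under products, by concatenating
independent samples. They separate points: the chance that `m` further labels lie below `x` is `x ^
m`, so all integrals of `f y * x ^ m` occur. Stone–Weierstrass then determines first `ρ` and, one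
level up, `α`. -/

open scoped ENNReal NNReal BoundedContinuousFunction
open Filter Topology

namespace RandomSubsequence

/-! ### Sorting samples with distinct labels -/

section Sorting

variable {A : Type*} {k n : ℕ}

theorem sort_eq_of_strictMono {x : Fin n → ℝ} {σ : Equiv.Perm (Fin n)} (h : StrictMono (x ∘ σ)) :
    Tuple.sort x = σ := by
  refine (Tuple.eq_sort_iff.2 ⟨h.monotone, fun i j hij he => ?_⟩).symm
  exact absurd he (h hij).ne

theorem strictMono_comp_sort {x : Fin n → ℝ} (hx : Function.Injective x) :
    StrictMono (x ∘ Tuple.sort x) :=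
  (Tuple.monotone_sort x).strictMono_of_injective (hx.comp (Tuple.sort x).injective)

theorem sort_comp_perm {x : Fin n → ℝ} (hx : Function.Injective x) (τ : Equiv.Perm (Fin n)) :
    Tuple.sort (x ∘ τ) = τ⁻¹ * Tuple.sort x := by
  refine sort_eq_of_strictMono ?_
  have h : (x ∘ τ) ∘ ⇑(τ⁻¹ * Tuple.sort x) = x ∘ Tuple.sort x := by
    ext i; simp
  rw [h]
  exact strictMono_comp_sort hx

theorem ios_comp_perm {x : Fin n → ℝ} (hx : Function.Injective x) (y : Fin n → A)
    (τ : Equiv.Perm (Fin n)) : ios (y ∘ τ) (x ∘ τ) = ios y x := by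
  ext i
  simp [ios, sort_comp_perm hx]

/-- The order embedding that enumerates the `x`-positions selected by the ranks in `j`. -/
theorem exists_orderEmb_ios_comp {x : Fin n → ℝ} (hx : Function.Injective x) (y : Fin n → A)
    (j : Fin k ↪o Fin n) :
    ∃ j' : Fin k ↪o Fin n, Set.range j' = Tuple.sort x '' Set.range j ∧
      (fun i => ios y x (j i)) = ios (y ∘ j') (x ∘ j') := by
  set s : Fin k → Fin n := fun i => Tuple.sort x (j i) with hs
  have hsi : Function.Injective s := (Tuple.sort x).injective.comp j.injective
  have hsm : StrictMono (s ∘ Tuple.sort s) :=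
    (Tuple.monotone_sort s).strictMono_of_injective (hsi.comp (Tuple.sort s).injective)
  refine ⟨OrderEmbedding.ofStrictMono _ hsm, ?_, ?_⟩
  · rw [OrderEmbedding.coe_ofStrictMono, (Tuple.sort s).surjective.range_comp, ← Set.range_comp]
    rfl
  -- `Tuple.sort s` lists the selected indices increasingly; its inverse returns to the order of
  -- ranks, along which `x` increases.
  · have hτ : Tuple.sort (x ∘ (s ∘ Tuple.sort s)) = (Tuple.sort s)⁻¹ := by
      refine sort_eq_of_strictMono fun a b hab => ?_
      simpa [hs] using! strictMono_comp_sort hx (j.strictMono hab)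
    ext i
    change y (s i) = y ((s ∘ Tuple.sort s) (Tuple.sort (x ∘ (s ∘ Tuple.sort s)) i))
    rw [hτ]
    simp

/-- Rank sets and index sets correspond under the sorting permutation; on a finite type the
injectivity of this correspondence already makes it a bijection. -/
theorem sum_ios_comp {M : Type*} [AddCommMonoid M] {x : Fin n → ℝ} (hx : Function.Injective x)
    (y : Fin n → A) (g : Word A k → M) :
    ∑ j : Fin k ↪o Fin n, g (fun i => ios y x (j i)) =
      ∑ j : Fin k ↪o Fin n, g (ios (y ∘ j) (x ∘ j)) := by
  choose J hJ hJ' using exists_orderEmb_ios_comp (k := k) hx y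
  have hinj : Function.Injective J := fun a b hab => by
    have h : Tuple.sort x '' Set.range a = Tuple.sort x '' Set.range b := by
      rw [← hJ, ← hJ, hab]
    exact OrderEmbedding.range_inj.1 ((Tuple.sort x).injective.image_injective h)
  exact Fintype.sum_bijective J (Finite.injective_iff_bijective.1 hinj) _ _
    fun j => by rw [hJ']

end Sorting

/-! ### Sampling from `C A` and consistency of mixtures -/

section Sampling

theorem pi_map_comp_injective {ι κ E : Type*} [Fintype ι] [Fintype κ] [MeasurableSpace E]
    (ρ : Measure E) [IsProbabilityMeasure ρ] {j : κ → ι} (hj : Function.Injective j) :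
    (Measure.pi fun _ : ι => ρ).map (fun p i => p (j i)) = Measure.pi fun _ : κ => ρ := by
  classical
  refine (Measure.pi_eq fun s hs => ?_).symm
  rw [Measure.map_apply (by fun_prop) (MeasurableSet.univ_pi hs)]
  have h : (fun (p : ι → E) (i : κ) => p (j i)) ⁻¹' Set.univ.pi s =
      Set.univ.pi fun a => ⋂ (i : κ) (_ : j i = a), s i := by
    ext p
    simp only [Set.mem_preimage, Set.mem_univ_pi, Set.mem_iInter]
    exact ⟨fun h a i hi => hi ▸ h i, fun h i => h (j i) i rfl⟩
  rw [h, Measure.pi_pi]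
  have h2 : ∀ a ∉ Finset.univ.image j, ρ (⋂ (i : κ) (_ : j i = a), s i) = 1 := fun a ha => by
    have : (⋂ (i : κ) (_ : j i = a), s i) = Set.univ := by
      simp only [Set.iInter_eq_univ]
      exact fun i hi => absurd (Finset.mem_image.2 ⟨i, by simp, hi⟩) ha
    rw [this, measure_univ]
  rw [← Finset.prod_subset (Finset.subset_univ (Finset.univ.image j)) fun a _ ha => h2 a ha,
    Finset.prod_image fun a _ b _ hab => hj hab]
  refine Finset.prod_congr rfl fun i _ => ?_
  congr 1
  ext z
  simp only [Set.mem_iInter, hj.eq_iff, forall_eq]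

variable {A : Type*} [MeasurableSpace A]

/-- The uniform distribution on `[0, 1]`, as a measure on the real line. -/
noncomputable def unif : Measure ℝ := volume.restrict (Set.Icc 0 1)

instance isProbabilityMeasure_unif : IsProbabilityMeasure unif :=
  ⟨by simp [unif]⟩

/-- The case `t = 1` forces all mass onto `[0, 1]`; the other values of `t` then fix the
distribution function of the second marginal. -/
theorem mem_C_iff_map_snd {ρ : ProbabilityMeasure (A × ℝ)} :
    ρ ∈ C A ↔ (ρ : Measure (A × ℝ)).map Prod.snd = unif := by
  have hset : ∀ s : Set ℝ, (Set.univ : Set A) ×ˢ s = Prod.snd ⁻¹' s := fun s => Set.univ_prod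
  have key : ρ ∈ C A ↔ ∀ t ∈ Set.Icc (0 : ℝ) 1,
      (ρ : Measure (A × ℝ)).map Prod.snd (Set.Icc 0 t) = ENNReal.ofReal t := by
    refine forall₂_congr fun t _ => ?_
    rw [Measure.map_apply measurable_snd measurableSet_Icc, hset]
  have hu : ∀ t ∈ Set.Icc (0 : ℝ) 1, unif (Set.Icc 0 t) = ENNReal.ofReal t := fun t ht => by
    rw [unif, Measure.restrict_apply measurableSet_Icc,
      Set.inter_eq_left.2 (Set.Icc_subset_Icc_right ht.2), Real.volume_Icc, sub_zero]
  rw [key]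
  refine ⟨fun h => ?_, fun h t ht => by rw [h, hu t ht]⟩
  have : IsProbabilityMeasure ((ρ : Measure (A × ℝ)).map Prod.snd) :=
    Measure.isProbabilityMeasure_map measurable_snd.aemeasurable
  -- For `t < 0` the right side is 0 because `ENNReal.ofReal` truncates, so one formula covers the
  -- whole line.
  have hae : ∀ (ν : Measure ℝ) [IsProbabilityMeasure ν],
      (∀ t ∈ Set.Icc (0 : ℝ) 1, ν (Set.Icc 0 t) = ENNReal.ofReal t) → ∀ t : ℝ,
        ν (Set.Iic t) = ENNReal.ofReal (min t 1) := by
    intro ν _ hν t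
    have h1 : ν (Set.Icc 0 1)ᶜ = 0 := by
      rw [prob_compl_eq_zero_iff measurableSet_Icc, hν 1 (by simp)]
      simp
    have h2 : ν (Set.Iic t) = ν (Set.Icc 0 (min t 1)) := by
      refine measure_congr ?_
      have : ∀ᵐ z ∂ν, z ∈ Set.Icc (0 : ℝ) 1 := h1
      filter_upwards [this] with z hz
      refine propext ?_
      change z ≤ t ↔ 0 ≤ z ∧ z ≤ min t 1
      simp [hz.1, hz.2]
    rw [h2]
    rcases le_or_gt 0 t with ht | ht
    · exact hν _ ⟨le_min ht zero_le_one, min_le_right _ _⟩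
    · rw [Set.Icc_eq_empty (by simp [ht]), measure_empty, eq_comm, ENNReal.ofReal_eq_zero]
      exact (min_le_left _ _).trans ht.le
  exact Measure.ext_of_Iic _ _ fun t => by rw [hae _ h, hae _ hu]

theorem map_snd_of_mem_C {ρ : ProbabilityMeasure (A × ℝ)} (hρ : ρ ∈ C A) :
    (ρ : Measure (A × ℝ)).map Prod.snd = unif :=
  mem_C_iff_map_snd.1 hρ

theorem ae_snd_mem_Icc {ρ : ProbabilityMeasure (A × ℝ)} (hρ : ρ ∈ C A) :
    ∀ᵐ z ∂(ρ : Measure (A × ℝ)), z.2 ∈ Set.Icc (0 : ℝ) 1 := by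
  refine ae_of_ae_map (p := fun t : ℝ => t ∈ Set.Icc (0 : ℝ) 1) measurable_snd.aemeasurable ?_
  rw [map_snd_of_mem_C hρ]
  exact ae_restrict_mem measurableSet_Icc

/-- Each coincidence set `x i = x j` is a proper subspace, hence Lebesgue null. -/
theorem ae_injective_pi_unif (k : ℕ) :
    ∀ᵐ x ∂(Measure.pi fun _ : Fin k => unif), Function.Injective x := by
  have h1 : (Measure.pi fun _ : Fin k => unif) ≪ volume := by
    simp only [unif]
    rw [← Measure.restrict_pi_pi]
    exact Measure.absolutelyContinuous_of_le Measure.restrict_le_self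
  have h2 : ∀ i j : Fin k, i ≠ j → ∀ᵐ x : Fin k → ℝ, x i ≠ x j := fun i j hij => by
    set L : Submodule ℝ (Fin k → ℝ) :=
      LinearMap.ker (LinearMap.proj (R := ℝ) (φ := fun _ : Fin k => ℝ) i - LinearMap.proj j)
    have hL : L ≠ ⊤ := fun h => by
      have : Pi.single i (1 : ℝ) ∈ L := h ▸ Submodule.mem_top
      simp [L, hij.symm] at this
    have := Measure.addHaar_submodule volume L hL
    refine measure_mono_null (fun x hx => ?_) this
    have hx' : x i = x j := by simpa using hx
    simp [L, hx']
  refine h1.ae_le ?_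
  have h3 : ∀ᵐ x : Fin k → ℝ, ∀ i j : Fin k, i ≠ j → x i ≠ x j := by
    simp only [ae_all_iff]
    exact h2
  filter_upwards [h3] with x hx i j hij
  by_contra hne
  exact hx i j hne hij

theorem ae_injective_snd {ρ : ProbabilityMeasure (A × ℝ)} (hρ : ρ ∈ C A) (k : ℕ) :
    ∀ᵐ p ∂(Measure.pi fun _ : Fin k => (ρ : Measure (A × ℝ))),
      Function.Injective fun i => (p i).2 := by
  have h : (Measure.pi fun _ : Fin k => (ρ : Measure (A × ℝ))).map (fun p i => (p i).2) =
      Measure.pi fun _ : Fin k => unif := by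
    have hm : ∀ _ : Fin k, AEMeasurable (Prod.snd : A × ℝ → ℝ) (ρ : Measure (A × ℝ)) :=
      fun _ => measurable_snd.aemeasurable
    have : ∀ _ : Fin k, SigmaFinite ((ρ : Measure (A × ℝ)).map Prod.snd) := fun _ => by
      rw [map_snd_of_mem_C hρ]; infer_instance
    rw [Measure.pi_map_pi hm]
    simp only [map_snd_of_mem_C hρ]
  have hmeas : Measurable fun (p : Fin k → A × ℝ) (i : Fin k) => (p i).2 := by fun_prop
  refine ae_of_ae_map (p := fun x : Fin k → ℝ => Function.Injective x) hmeas.aemeasurable ?_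
  rw [h]
  exact ae_injective_pi_unif k

theorem lintegral_spread (ρ : ProbabilityMeasure (A × ℝ)) (k : ℕ) {g : Word A k → ℝ≥0∞}
    (hg : Measurable g) :
    ∫⁻ w, g w ∂(spread ρ k : Measure (Word A k)) =
      ∫⁻ p, g (ios (fun i => (p i).1) (fun i => (p i).2))
        ∂(Measure.pi fun _ : Fin k => (ρ : Measure (A × ℝ))) :=
  lintegral_map hg (measurable_ios k)

theorem card_orderEmb (k n : ℕ) : Fintype.card (Fin k ↪o Fin n) = n.choose k := by
  have e : (Fin k ↪o Fin n) ≃ {s : Finset (Fin n) // s ∈ Finset.powersetCard k Finset.univ} :=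
    { toFun := fun j => ⟨Finset.univ.map j.toEmbedding, by simp [Finset.mem_powersetCard]⟩
      invFun := fun s => s.1.orderEmbOfFin (Finset.mem_powersetCard.1 s.2).2
      left_inv := fun j => by
        refine OrderEmbedding.range_inj.1 ?_
        simp
      right_inv := fun s => by
        refine Subtype.ext ?_
        rw [← Finset.coe_inj]
        simp }
  rw [Fintype.card_congr e, Fintype.card_coe, Finset.card_powersetCard, Finset.card_univ,
    Fintype.card_fin]

theorem rss_apply {n : ℕ} (w : Word A n) (k : ℕ) {B : Set (Word A k)} (hB : MeasurableSet B) :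
    rss w k B = ((n.choose k : ℕ) : ℝ≥0∞)⁻¹ *
      ∑ j : Fin k ↪o Fin n, B.indicator 1 (fun i => w (j i)) := by
  simp only [rss, Measure.smul_apply, Measure.finsetSum_apply, smul_eq_mul,
    Measure.dirac_apply' _ hB]

/-- By `sum_ios_comp`, averaging over ranks equals averaging over index sets, and each of the
`n.choose k` subsamples is i.i.d. with law `ρ`, so all terms are equal. -/
theorem spread_eq_bind_rss {ρ : ProbabilityMeasure (A × ℝ)} (hρ : ρ ∈ C A) {k n : ℕ}
    (hkn : k ≤ n) :
    (spread ρ k : Measure (Word A k)) =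
      (spread ρ n : Measure (Word A n)).bind (fun w => rss w k) := by
  ext B hB
  have hmB : Measurable (B.indicator (1 : Word A k → ℝ≥0∞)) := measurable_one.indicator hB
  have hk : Measurable fun p : Fin k → A × ℝ =>
      B.indicator (1 : Word A k → ℝ≥0∞) (ios (fun i => (p i).1) (fun i => (p i).2)) :=
    hmB.comp (measurable_ios k)
  have hsub : ∀ j : Fin k ↪o Fin n, Measurable fun (p : Fin n → A × ℝ) (i : Fin k) => p (j i) :=
    fun j => by fun_prop
  rw [bind_rss_apply _ _ hB, lintegral_spread ρ n (g := fun w => rss w k B)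
    ((Measure.measurable_coe hB).comp (measurable_rss n k))]
  simp only [rss_apply _ k hB]
  rw [lintegral_const_mul' _ _ (by simp [Nat.choose_eq_zero_iff, hkn])]
  have h1 : ∫⁻ p, ∑ j : Fin k ↪o Fin n, B.indicator (1 : Word A k → ℝ≥0∞)
        (fun i => ios (fun i => (p i).1) (fun i => (p i).2) (j i))
        ∂(Measure.pi fun _ : Fin n => (ρ : Measure (A × ℝ))) =
      ∑ j : Fin k ↪o Fin n, (spread ρ k : Measure (Word A k)) B := by
    rw [lintegral_congr_ae (g := fun p => ∑ j : Fin k ↪o Fin n, B.indicator (1 : Word A k → ℝ≥0∞)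
      (ios (fun i => (p (j i)).1) (fun i => (p (j i)).2)))]
    · rw [lintegral_finsetSum Finset.univ (f := fun (j : Fin k ↪o Fin n) (p : Fin n → A × ℝ) =>
        B.indicator (1 : Word A k → ℝ≥0∞) (ios (fun i => (p (j i)).1) (fun i => (p (j i)).2)))
        fun j _ => hk.comp (hsub j)]
      refine Finset.sum_congr rfl fun j _ => ?_
      rw [← lintegral_map hk (hsub j), pi_map_comp_injective _ j.injective,
        ← lintegral_spread ρ k hmB, lintegral_indicator_one hB]
    · filter_upwards [ae_injective_snd hρ n] with p hp
      exact sum_ios_comp hp (fun i => (p i).1) (B.indicator (1 : Word A k → ℝ≥0∞))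
  rw [h1, Finset.sum_const, Finset.card_univ, card_orderEmb, nsmul_eq_mul, ← mul_assoc,
    ENNReal.inv_mul_cancel (by simp [Nat.choose_eq_zero_iff, hkn]) (by simp), one_mul]

theorem isConsistent_spreadMixture (α : ProbabilityMeasure (C A)) :
    IsConsistent fun k : ℕ+ => spreadMixture α k := by
  intro k n hkn
  have hs : ∀ m : ℕ, Measurable fun ρ : C A =>
      (spread (ρ : ProbabilityMeasure (A × ℝ)) m : Measure (Word A m)) :=
    fun m => (measurable_spread m).comp measurable_subtype_coe
  change (α : Measure (C A)).bind _ = ((α : Measure (C A)).bind _).bind _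
  rw [Measure.bind_bind (hs n).aemeasurable (measurable_rss n k).aemeasurable]
  congr 1
  ext1 ρ
  exact spread_eq_bind_rss ρ.2 hkn

end Sampling

/-! ### Order-invariant functionals of a sample -/

section OrderInvariance

variable {A : Type*}

/-- A functional of a finite sample of pairs `(y, x)` is order invariant if, on samples with
distinct `x`-values, it depends on the `x`-values through their relative order only. -/
def OrderInvariant {k : ℕ} (h : (Fin k → A × ℝ) → ℝ≥0∞) : Prop :=
  ∀ (y : Fin k → A) (x x' : Fin k → ℝ), Function.Injective x → Function.Injective x' →
    (∀ i j, x i < x j ↔ x' i < x' j) → h (fun i => (y i, x i)) = h (fun i => (y i, x' i))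

theorem OrderInvariant.append {k l : ℕ} {h₁ : (Fin k → A × ℝ) → ℝ≥0∞}
    {h₂ : (Fin l → A × ℝ) → ℝ≥0∞} (H₁ : OrderInvariant h₁) (H₂ : OrderInvariant h₂) :
    OrderInvariant fun p : Fin (k + l) → A × ℝ =>
      h₁ (fun i => p (Fin.castAdd l i)) * h₂ (fun i => p (Fin.natAdd k i)) := by
  intro y x x' hx hx' hxx'
  beta_reduce
  rw [H₁ (fun i => y (Fin.castAdd l i)) (fun i => x (Fin.castAdd l i))
      (fun i => x' (Fin.castAdd l i)) (hx.comp (Fin.castAdd_injective k l))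
      (hx'.comp (Fin.castAdd_injective k l)) fun i j => hxx' _ _,
    H₂ (fun i => y (Fin.natAdd k i)) (fun i => x (Fin.natAdd k i))
      (fun i => x' (Fin.natAdd k i)) (hx.comp (Fin.natAdd_injective l k))
      (hx'.comp (Fin.natAdd_injective l k)) fun i j => hxx' _ _]

/-- The canonical sample with relative order `σ` whose induced order statistics are `w`. -/
def unsort {k : ℕ} (σ : Equiv.Perm (Fin k)) (w : Word A k) : Fin k → A × ℝ :=
  fun i => (w (σ⁻¹ i), ((σ⁻¹ i : Fin k) : ℕ))

theorem OrderInvariant.eq_unsort {k : ℕ} {h : (Fin k → A × ℝ) → ℝ≥0∞} (H : OrderInvariant h)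
    (p : Fin k → A × ℝ) (hp : Function.Injective fun i => (p i).2) :
    h p = h (unsort (Tuple.sort fun i => (p i).2) (ios (fun i => (p i).1) (fun i => (p i).2))) := by
  have h1 := H (fun i => (p i).1) (fun i => (p i).2)
    (fun i => (((Tuple.sort fun i => (p i).2)⁻¹ i : Fin k) : ℕ)) hp
    (fun i j hij => by simpa [Fin.val_inj] using hij) (fun i j => by
      have := (strictMono_comp_sort hp).lt_iff_lt (a := (Tuple.sort fun i => (p i).2)⁻¹ i)
        (b := (Tuple.sort fun i => (p i).2)⁻¹ j)
      simpa using this)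
  refine h1.trans (congrArg h (funext fun i => ?_))
  simp [unsort, ios]

variable [MeasurableSpace A]

theorem lintegral_pi_append {E : Type*} [MeasurableSpace E] (ρ : Measure E)
    [IsProbabilityMeasure ρ] (k l : ℕ) {h : (Fin (k + l) → E) → ℝ≥0∞} (hh : Measurable h) :
    ∫⁻ p, h p ∂(Measure.pi fun _ : Fin (k + l) => ρ) =
      ∫⁻ a, ∫⁻ b, h (Fin.append a b) ∂(Measure.pi fun _ : Fin l => ρ)
        ∂(Measure.pi fun _ : Fin k => ρ) := by
  have hm : Measurable fun ab : (Fin k → E) × (Fin l → E) => Fin.append ab.1 ab.2 := by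
    refine measurable_pi_lambda _ fun i => ?_
    refine Fin.addCases (fun i => ?_) (fun i => ?_) i
    · simp only [Fin.append_left]; fun_prop
    · simp only [Fin.append_right]; fun_prop
  have hpi : (Measure.pi fun _ : Fin (k + l) => ρ) =
      ((Measure.pi fun _ : Fin k => ρ).prod (Measure.pi fun _ : Fin l => ρ)).map
        fun ab => Fin.append ab.1 ab.2 := by
    refine Measure.pi_eq fun s hs => ?_
    rw [Measure.map_apply hm (MeasurableSet.univ_pi hs)]
    have : (fun ab : (Fin k → E) × (Fin l → E) => Fin.append ab.1 ab.2) ⁻¹' Set.univ.pi s =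
        (Set.univ.pi fun i => s (Fin.castAdd l i)) ×ˢ (Set.univ.pi fun i => s (Fin.natAdd k i)) := by
      ext ab
      simp only [Set.mem_preimage, Set.mem_univ_pi, Set.mem_prod]
      refine ⟨fun h => ⟨fun i => ?_, fun i => ?_⟩, fun h i => ?_⟩
      · simpa using h (Fin.castAdd l i)
      · simpa using h (Fin.natAdd k i)
      · refine Fin.addCases (fun i => ?_) (fun i => ?_) i
        · simpa using h.1 i
        · simpa using h.2 i
    rw [this, Measure.prod_prod, Measure.pi_pi, Measure.pi_pi, Fin.prod_univ_add]
  rw [hpi, lintegral_map hh hm]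
  exact lintegral_prod (fun ab : (Fin k → E) × (Fin l → E) => h (Fin.append ab.1 ab.2))
    (hh.comp hm).aemeasurable

theorem lintegral_pi_mul_append {E : Type*} [MeasurableSpace E] (ρ : Measure E)
    [IsProbabilityMeasure ρ] {k l : ℕ} {h₁ : (Fin k → E) → ℝ≥0∞} {h₂ : (Fin l → E) → ℝ≥0∞}
    (H₁ : Measurable h₁) (H₂ : Measurable h₂) :
    ∫⁻ p, h₁ (fun i => p (Fin.castAdd l i)) * h₂ (fun i => p (Fin.natAdd k i))
        ∂(Measure.pi fun _ : Fin (k + l) => ρ) =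
      (∫⁻ p, h₁ p ∂(Measure.pi fun _ : Fin k => ρ)) *
        ∫⁻ p, h₂ p ∂(Measure.pi fun _ : Fin l => ρ) := by
  rw [lintegral_pi_append ρ k l (by fun_prop), ← lintegral_mul_const _ H₁]
  refine lintegral_congr fun a => ?_
  simp only [Fin.append_left, Fin.append_right]
  rw [lintegral_const_mul _ H₂]

theorem measurable_unsort {k : ℕ} (σ : Equiv.Perm (Fin k)) :
    Measurable (unsort σ : Word A k → Fin k → A × ℝ) := by
  unfold unsort
  fun_prop

/-- This is the independence of the sorted word from the ranking permutation, which is uniform: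
relabelling an i.i.d. sample preserves its law and its sorted word but permutes the ranking events
transitively. -/
theorem setLIntegral_sort_eq {ρ : ProbabilityMeasure (A × ℝ)} (hρ : ρ ∈ C A) {k : ℕ}
    (σ : Equiv.Perm (Fin k)) {g : Word A k → ℝ≥0∞} (hg : Measurable g) :
    ∫⁻ p in {p : Fin k → A × ℝ | Tuple.sort (fun i => (p i).2) = σ},
        g (ios (fun i => (p i).1) (fun i => (p i).2))
        ∂(Measure.pi fun _ : Fin k => (ρ : Measure (A × ℝ))) =
      ((k.factorial : ℕ) : ℝ≥0∞)⁻¹ * ∫⁻ w, g w ∂(spread ρ k : Measure (Word A k)) := by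
  set P : Measure (Fin k → A × ℝ) := Measure.pi fun _ : Fin k => (ρ : Measure (A × ℝ)) with hP
  set S : Equiv.Perm (Fin k) → Set (Fin k → A × ℝ) :=
    fun σ => {p | Tuple.sort (fun i => (p i).2) = σ} with hS
  set G : (Fin k → A × ℝ) → ℝ≥0∞ := fun p => g (ios (fun i => (p i).1) (fun i => (p i).2)) with hG
  have hGm : Measurable G := hg.comp (measurable_ios k)
  have hSm : ∀ σ, MeasurableSet (S σ) := fun σ => by
    have hm : Measurable (fun p : Fin k → A × ℝ => fun i => (p i).2) := by fun_prop
    exact hm (measurableSet_sort_eq σ)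
  -- Relabelling by `τ * σ⁻¹` turns the event `S τ` into `S σ`.
  have hperm : ∀ σ τ, ∫⁻ p in S σ, G p ∂P = ∫⁻ p in S τ, G p ∂P := fun σ τ => by
    have hj : P.map (fun p i => p ((τ * σ⁻¹) i)) = P :=
      pi_map_comp_injective _ (τ * σ⁻¹).injective
    have hjm : Measurable fun (p : Fin k → A × ℝ) (i : Fin k) => p ((τ * σ⁻¹) i) := by fun_prop
    rw [← lintegral_indicator (hSm σ), ← lintegral_indicator (hSm τ)]
    conv_lhs => rw [← hj]
    rw [lintegral_map (hGm.indicator (hSm σ)) hjm]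
    refine lintegral_congr_ae ?_
    filter_upwards [ae_injective_snd hρ k] with p hp
    have h1 : Tuple.sort (fun i => (p ((τ * σ⁻¹) i)).2) =
        (τ * σ⁻¹)⁻¹ * Tuple.sort fun i => (p i).2 := sort_comp_perm hp (τ * σ⁻¹)
    have h2 : G (fun i => p ((τ * σ⁻¹) i)) = G p :=
      congrArg g (ios_comp_perm hp (fun i => (p i).1) (τ * σ⁻¹))
    have h3 : (fun i => p ((τ * σ⁻¹) i)) ∈ S σ ↔ p ∈ S τ := by
      change Tuple.sort (fun i => (p ((τ * σ⁻¹) i)).2) = σ ↔ Tuple.sort (fun i => (p i).2) = τ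
      rw [h1, inv_mul_eq_iff_eq_mul, inv_mul_cancel_right]
    by_cases hpS : p ∈ S τ
    · rw [Set.indicator_of_mem hpS, Set.indicator_of_mem (h3.2 hpS), h2]
    · rw [Set.indicator_of_notMem hpS, Set.indicator_of_notMem (fun h => hpS (h3.1 h))]
  have hsum : ∫⁻ w, g w ∂(spread ρ k : Measure (Word A k)) =
      (k.factorial : ℕ) * ∫⁻ p in S σ, G p ∂P := by
    have hU : (⋃ σ, S σ) = Set.univ := Set.eq_univ_of_forall fun p => Set.mem_iUnion.2 ⟨_, rfl⟩
    have hd : Pairwise (Function.onFun Disjoint S) := fun a b hab =>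
      Set.disjoint_left.2 fun p hpa hpb => hab (hpa.symm.trans hpb)
    rw [lintegral_spread ρ k hg, ← setLIntegral_univ, ← hU, lintegral_iUnion hSm hd, tsum_fintype,
      Finset.sum_congr rfl fun τ _ => hperm τ σ, Finset.sum_const, Finset.card_univ,
      Fintype.card_perm, Fintype.card_fin, nsmul_eq_mul]
  rw [hsum, ← mul_assoc, ENNReal.inv_mul_cancel (by simp [Nat.factorial_ne_zero]) (by simp),
    one_mul]

/-- The expectation of an order-invariant functional of a sample from `ρ` is an expectation with
respect to `SPREAD(ρ, k)`. -/
theorem OrderInvariant.lintegral_eq {k : ℕ} {h : (Fin k → A × ℝ) → ℝ≥0∞} (H : OrderInvariant h)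
    (hh : Measurable h) {ρ : ProbabilityMeasure (A × ℝ)} (hρ : ρ ∈ C A) :
    ∫⁻ p, h p ∂(Measure.pi fun _ : Fin k => (ρ : Measure (A × ℝ))) =
      ∫⁻ w, ((k.factorial : ℕ) : ℝ≥0∞)⁻¹ * ∑ σ, h (unsort σ w)
        ∂(spread ρ k : Measure (Word A k)) := by
  set S : Equiv.Perm (Fin k) → Set (Fin k → A × ℝ) :=
    fun σ => {p | Tuple.sort (fun i => (p i).2) = σ} with hS
  have hSm : ∀ σ, MeasurableSet (S σ) := fun σ => by
    have hm : Measurable (fun p : Fin k → A × ℝ => fun i => (p i).2) := by fun_prop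
    exact hm (measurableSet_sort_eq σ)
  have hU : (⋃ σ, S σ) = Set.univ := Set.eq_univ_of_forall fun p => Set.mem_iUnion.2 ⟨_, rfl⟩
  have hd : Pairwise (Function.onFun Disjoint S) := fun a b hab =>
    Set.disjoint_left.2 fun p hpa hpb => hab (hpa.symm.trans hpb)
  have hm : ∀ σ, Measurable fun w : Word A k => h (unsort σ w) :=
    fun σ => hh.comp (measurable_unsort σ)
  rw [lintegral_const_mul _ (Finset.measurable_sum _ fun σ _ => hm σ),
    lintegral_finsetSum _ fun σ _ => hm σ, Finset.mul_sum, ← setLIntegral_univ, ← hU,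
    lintegral_iUnion hSm hd, tsum_fintype]
  refine Finset.sum_congr rfl fun σ _ => ?_
  rw [← setLIntegral_sort_eq hρ σ (hm σ)]
  refine setLIntegral_congr_fun_ae (hSm σ) ?_
  filter_upwards [ae_injective_snd hρ k] with p hp hpσ
  rw [H.eq_unsort p hp]
  have : Tuple.sort (fun i => (p i).2) = σ := hpσ
  rw [this]

theorem OrderInvariant.lintegral_mixture {k : ℕ} {h : (Fin k → A × ℝ) → ℝ≥0∞}
    (H : OrderInvariant h) (hh : Measurable h) (α : ProbabilityMeasure (C A)) :
    ∫⁻ ρ : C A, ∫⁻ p, h p ∂(Measure.pi fun _ : Fin k => ((ρ : ProbabilityMeasure (A × ℝ)) :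
        Measure (A × ℝ))) ∂(α : Measure (C A)) =
      ∫⁻ w, ((k.factorial : ℕ) : ℝ≥0∞)⁻¹ * ∑ σ, h (unsort σ w)
        ∂(spreadMixture α k : Measure (Word A k)) := by
  have hs : Measurable fun ρ : C A =>
      (spread (ρ : ProbabilityMeasure (A × ℝ)) k : Measure (Word A k)) :=
    (measurable_spread _).comp measurable_subtype_coe
  change _ = ∫⁻ w, _ ∂((α : Measure (C A)).bind _)
  have hm : Measurable fun w : Word A k =>
      ((k.factorial : ℕ) : ℝ≥0∞)⁻¹ * ∑ σ, h (unsort σ w) :=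
    (Finset.measurable_sum _ fun σ _ => hh.comp (measurable_unsort σ)).const_mul _
  rw [Measure.lintegral_bind hs.aemeasurable hm.aemeasurable]
  exact lintegral_congr fun ρ => H.lintegral_eq hh ρ.2

end OrderInvariance

/-! ### Compact models of standard Borel spaces -/

section CompactModel

/-- Every standard Borel space is measurably isomorphic to a compact metrizable space. -/
theorem exists_measurableEquiv_compact (A : Type*) [MeasurableSpace A] [StandardBorelSpace A] :
    ∃ (K : Type) (_ : TopologicalSpace K) (_ : MeasurableSpace K), CompactSpace K ∧
      TopologicalSpace.MetrizableSpace K ∧ BorelSpace K ∧ Nonempty (A ≃ᵐ K) := by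
  by_cases hc : Countable A
  · rcases finite_or_infinite A with hf | hf
    · obtain ⟨n, ⟨e⟩⟩ := Finite.exists_equiv_fin A
      exact ⟨Fin n, inferInstance, inferInstance, inferInstance, inferInstance, inferInstance,
        ⟨PolishSpace.Equiv.measurableEquiv e⟩⟩
    -- The compact model in the countably infinite case is a convergent sequence with its limit; in
    -- the uncountable case it is Cantor space.
    · set u : ℕ → ℝ := fun n => 1 / ((n : ℝ) + 1) with hu
      have hK : IsCompact (insert 0 (Set.range u)) :=
        tendsto_one_div_add_atTop_nhds_zero_nat.isCompact_insert_range
      have hcount : (insert 0 (Set.range u)).Countable := (Set.countable_range u).insert 0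
      have hinj : Function.Injective u := fun a b hab => by
        have h := inv_injective (by simpa [hu] using hab : ((a : ℝ) + 1)⁻¹ = ((b : ℝ) + 1)⁻¹)
        exact_mod_cast add_right_cancel h
      have hinf : (insert 0 (Set.range u)).Infinite :=
        (Set.infinite_range_of_injective hinj).mono (Set.subset_insert _ _)
      have : Countable (insert 0 (Set.range u) : Set ℝ) := hcount.to_subtype
      have : Infinite (insert 0 (Set.range u) : Set ℝ) := hinf.to_subtype
      have : CompactSpace (insert 0 (Set.range u) : Set ℝ) := isCompact_iff_compactSpace.1 hK
      obtain ⟨e⟩ := nonempty_equiv_of_countable (α := A) (β := (insert 0 (Set.range u) : Set ℝ))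
      have : StandardBorelSpace (insert 0 (Set.range u) : Set ℝ) := hK.measurableSet.standardBorel
      exact ⟨(insert 0 (Set.range u) : Set ℝ), inferInstance, inferInstance, inferInstance,
        inferInstance, inferInstance, ⟨PolishSpace.Equiv.measurableEquiv e⟩⟩
  · exact ⟨ℕ → Bool, inferInstance, inferInstance, inferInstance, inferInstance, inferInstance,
      ⟨PolishSpace.measurableEquivNatBoolOfNotCountable hc⟩⟩

/-- The σ-field of a standard Borel space is the Borel σ-field of some compact metrizable
topology. -/
theorem exists_compact_metrizable_topology (A : Type*) [MeasurableSpace A] [StandardBorelSpace A] :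
    ∃ _ : TopologicalSpace A, CompactSpace A ∧ TopologicalSpace.MetrizableSpace A ∧
      BorelSpace A := by
  obtain ⟨K, tK, mK, hK, hK', hK'', ⟨e⟩⟩ := exists_measurableEquiv_compact A
  let tA : TopologicalSpace A := TopologicalSpace.induced e tK
  let h : A ≃ₜ K := e.toEquiv.toHomeomorphOfIsInducing ⟨rfl⟩
  refine ⟨tA, h.symm.compactSpace, h.isEmbedding.metrizableSpace, ⟨?_⟩⟩
  rw [borel_comap, ← hK''.measurable_eq]
  exact e.measurableEmbedding.comap_eq.symm

end CompactModel

/-! ### Evaluation σ-field and weak topology -/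

section WeakTopology

variable {E : Type*} [TopologicalSpace E] [TopologicalSpace.PseudoMetrizableSpace E]
  [MeasurableSpace E] [BorelSpace E]

/-- The mass of a closed set is a pointwise limit of integrals of bounded continuous functions, and
closed sets form a generating π-system. -/
theorem measurable_of_continuous_probabilityMeasure {T : Type*} [TopologicalSpace T]
    {Φ : T → ProbabilityMeasure E} (hΦ : Continuous Φ) : Measurable[borel T] Φ := by
  borelize T
  refine Measurable.subtype_mk (f := fun t => (Φ t : Measure E)) ?_
  refine Measurable.measure_of_isPiSystem_of_isProbabilityMeasure
    (BorelSpace.measurable_eq.trans borel_eq_generateFrom_isClosed) isPiSystem_isClosed ?_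
  intro F hF
  refine measurable_of_tendsto_metrizable (f := fun n t =>
    ∫⁻ z, (hF.apprSeq n z : ℝ≥0∞) ∂(Φ t : Measure E)) (fun n => ?_) ?_
  · exact ((ProbabilityMeasure.continuous_lintegral_boundedContinuousFunction
      (hF.apprSeq n)).comp hΦ).measurable
  · exact tendsto_pi_nhds.2 fun t => HasOuterApproxClosed.tendsto_lintegral_apprSeq hF _

/-- On a second countable set of probability measures on a metrizable space, the evaluation σ-field
is the Borel σ-field of the weak topology. -/
theorem borelSpace_subtype_probabilityMeasure (S : Set (ProbabilityMeasure E))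
    [SecondCountableTopology S] : BorelSpace S := by
  refine ⟨le_antisymm ?_ ?_⟩
  · exact measurable_iff_comap_le.1 (measurable_of_continuous_probabilityMeasure
      (continuous_subtype_val (p := (· ∈ S))))
  · let Φ : (E →ᵇ ℝ≥0) → S → ℝ≥0 := fun f ρ =>
      (∫⁻ z, (f z : ℝ≥0∞) ∂((ρ : ProbabilityMeasure E) : Measure E)).toNNReal
    -- The weak topology is initial for the integrals `Φ f`. Second countability lets their
    -- preimages of open sets, a subbasis, generate the Borel σ-field.
    have hind : (inferInstance : TopologicalSpace S) =
        ⨅ f, TopologicalSpace.induced (Φ f) inferInstance := by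
      have h : IsInducing fun (ρ : S) (f : E →ᵇ ℝ≥0) => Φ f ρ :=
        (((⟨rfl⟩ : IsInducing (fun (x : WeakDual ℝ≥0 (E →ᵇ ℝ≥0)) (f : E →ᵇ ℝ≥0) => x f)).comp
          (⟨rfl⟩ : IsInducing (FiniteMeasure.toWeakDualBCNN (Ω := E)))).comp
          (⟨rfl⟩ : IsInducing (ProbabilityMeasure.toFiniteMeasure (Ω := E)))).comp
          (IsInducing.subtypeVal (t := S))
      rw [h.eq_induced, Pi.topologicalSpace, induced_iInf]
      simp only [induced_compose]
      rfl
    have hgen : (inferInstance : TopologicalSpace S) = TopologicalSpace.generateFrom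
        (⋃ f, {s | ∃ U, IsOpen U ∧ Φ f ⁻¹' U = s}) := by
      rw [hind, generateFrom_iUnion]
      refine iInf_congr fun f => ?_
      exact (TopologicalSpace.generateFrom_setOfPred_isOpen (TopologicalSpace.induced (Φ f) inferInstance)).symm
    rw [borel_eq_generateFrom_of_subbasis hgen]
    refine MeasurableSpace.generateFrom_le fun s hs => ?_
    obtain ⟨f, U, hU, rfl⟩ := Set.mem_iUnion.1 hs
    have hm : Measurable (Φ f) := by
      refine Measurable.ennreal_toNNReal ?_
      exact (Measure.measurable_lintegral (by fun_prop)).comp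
        (measurable_subtype_coe.comp measurable_subtype_coe)
    exact hm hU.measurableSet

end WeakTopology

/-! ### Compactness of `C A` and continuity of `spread` -/

section CompactC

theorem continuousAt_ios {A : Type*} [TopologicalSpace A] {k : ℕ} {p : Fin k → A × ℝ}
    (hp : Function.Injective fun i => (p i).2) :
    ContinuousAt (fun p : Fin k → A × ℝ => ios (fun i => (p i).1) (fun i => (p i).2)) p := by
  set σ := Tuple.sort fun i => (p i).2 with hσ
  have hev : ∀ᶠ q : Fin k → A × ℝ in 𝓝 p, Tuple.sort (fun i => (q i).2) = σ := by
    have h : ∀ i j : Fin k, i < j → ∀ᶠ q : Fin k → A × ℝ in 𝓝 p, (q (σ i)).2 < (q (σ j)).2 :=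
      fun i j hij => by
        have hc : ∀ m : Fin k, Continuous fun q : Fin k → A × ℝ => (q m).2 := fun m => by fun_prop
        exact (hc (σ i)).continuousAt.eventually_lt (hc (σ j)).continuousAt
          (strictMono_comp_sort hp hij)
    have h' : ∀ᶠ q : Fin k → A × ℝ in 𝓝 p, ∀ i j : Fin k, i < j → (q (σ i)).2 < (q (σ j)).2 := by
      simp only [eventually_all]
      exact h
    filter_upwards [h'] with q hq
    exact sort_eq_of_strictMono fun i j hij => hq i j hij
  have hc : Continuous fun (q : Fin k → A × ℝ) (i : Fin k) => (q (σ i)).1 := by fun_prop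
  refine hc.continuousAt.congr ?_
  filter_upwards [hev] with q hq
  exact funext fun i => congrArg (fun τ : Equiv.Perm (Fin k) => (q (τ i)).1) hq.symm

variable {A : Type*} [MeasurableSpace A] [TopologicalSpace A] [CompactSpace A]
  [TopologicalSpace.MetrizableSpace A] [BorelSpace A]

theorem secondCountable_of_compact_metrizable (X : Type*) [TopologicalSpace X] [CompactSpace X]
    [TopologicalSpace.PseudoMetrizableSpace X] : SecondCountableTopology X := by
  let := TopologicalSpace.pseudoMetrizableSpacePseudoMetric X
  infer_instance

/-- Prokhorov: prescribing the second marginal is a closed condition, and all members live on the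
one compact set `A × [0, 1]`. -/
theorem isCompact_C : IsCompact (C A) := by
  have := secondCountable_of_compact_metrizable A
  have hcl : IsClosed (C A) := by
    have : C A = (fun ρ : ProbabilityMeasure (A × ℝ) => ρ.map continuous_snd.aemeasurable) ⁻¹'
        {(⟨unif, inferInstance⟩ : ProbabilityMeasure ℝ)} := by
      ext ρ
      rw [mem_C_iff_map_snd]
      exact (ProbabilityMeasure.toMeasure_injective.eq_iff
        (a := ρ.map continuous_snd.aemeasurable)
        (b := (⟨unif, inferInstance⟩ : ProbabilityMeasure ℝ)))
    rw [this]
    exact isClosed_singleton.preimage (ProbabilityMeasure.continuous_map continuous_snd)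
  rw [← hcl.closure_eq]
  refine isCompact_closure_of_isTightMeasureSet
    (isTightMeasureSet_iff_exists_isCompact_measure_compl_le.2 fun ε _ => ?_)
  refine ⟨Set.univ ×ˢ Set.Icc 0 1, isCompact_univ.prod isCompact_Icc, ?_⟩
  rintro _ ⟨ρ, hρ, rfl⟩
  have h : (ρ : Measure (A × ℝ)) (Set.univ ×ˢ Set.Icc 0 1)ᶜ = 0 := by
    refine measure_mono_null (fun z hz => ?_) (ae_snd_mem_Icc hρ)
    simpa using hz
  rw [h]
  exact bot_le

instance compactSpace_C : CompactSpace (C A) := isCompact_iff_compactSpace.1 isCompact_C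

instance metrizableSpace_C : TopologicalSpace.MetrizableSpace (C A) := by
  have := secondCountable_of_compact_metrizable A
  infer_instance

instance borelSpace_C : BorelSpace (C A) := by
  have := secondCountable_of_compact_metrizable A
  have := secondCountable_of_compact_metrizable (C A)
  exact borelSpace_subtype_probabilityMeasure _

/-- Product measures depend continuously on `ρ`, and sorting is discontinuous only at tied labels, a
null set; the portmanteau criterion for closed sets combines the two. -/
theorem continuous_spread (k : ℕ) :
    Continuous fun ρ : C A => spread (ρ : ProbabilityMeasure (A × ℝ)) k := by
  have := secondCountable_of_compact_metrizable A
  refine continuous_iff_continuousAt.2 fun ρ => ?_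
  have hpi : Continuous fun ρ : C A =>
      ProbabilityMeasure.pi fun _ : Fin k => (ρ : ProbabilityMeasure (A × ℝ)) :=
    ProbabilityMeasure.continuous_pi.comp (continuous_pi fun _ => continuous_subtype_val)
  refine tendsto_of_forall_isClosed_limsup_le' fun F hF => ?_
  set f : (Fin k → A × ℝ) → Word A k := fun p => ios (fun i => (p i).1) (fun i => (p i).2) with hf
  have hval : ∀ ρ : C A, (spread (ρ : ProbabilityMeasure (A × ℝ)) k : Measure (Word A k)) F =
      (ProbabilityMeasure.pi fun _ : Fin k => (ρ : ProbabilityMeasure (A × ℝ)) :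
        Measure (Fin k → A × ℝ)) (f ⁻¹' F) :=
    fun ρ => Measure.map_apply (measurable_ios k) hF.measurableSet
  calc limsup (fun ρ : C A =>
        (spread (ρ : ProbabilityMeasure (A × ℝ)) k : Measure (Word A k)) F) (𝓝 ρ)
      ≤ limsup (fun ρ : C A => (ProbabilityMeasure.pi fun _ : Fin k =>
          (ρ : ProbabilityMeasure (A × ℝ)) : Measure (Fin k → A × ℝ)) (closure (f ⁻¹' F))) (𝓝 ρ) :=
        limsup_le_limsup (Eventually.of_forall fun ρ => (hval ρ).trans_le (measure_mono subset_closure))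
    _ ≤ (ProbabilityMeasure.pi fun _ : Fin k => (ρ : ProbabilityMeasure (A × ℝ)) :
          Measure (Fin k → A × ℝ)) (closure (f ⁻¹' F)) :=
        ProbabilityMeasure.limsup_measure_closed_le_of_tendsto (hpi.tendsto ρ) isClosed_closure
    _ ≤ (ProbabilityMeasure.pi fun _ : Fin k => (ρ : ProbabilityMeasure (A × ℝ)) :
          Measure (Fin k → A × ℝ)) (f ⁻¹' F) := by
        refine measure_mono_ae ?_
        filter_upwards [ae_injective_snd ρ.2 k] with p hp hpF
        have h := mem_closure_image (continuousAt_ios hp) hpF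
        exact hF.closure_subset_iff.2 (Set.image_preimage_subset f F) h
    _ = _ := (hval ρ).symm

end CompactC

/-! ### Existence of the mixing measure -/

section Existence

/-- The index of the interval `[i / (n + 1), (i + 1) / (n + 1))` that contains `x ∈ [0, 1)`. -/
noncomputable def cell (n : ℕ) (x : ℝ) : Fin (n + 1) :=
  ⟨min ⌊(n + 1 : ℝ) * x⌋₊ n, Nat.lt_succ_of_le (min_le_right _ _)⟩

theorem measurable_cell (n : ℕ) : Measurable (cell n) := by
  have h : Measurable fun x : ℝ => ⌊(n + 1 : ℝ) * x⌋₊ := by fun_prop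
  exact (measurable_from_nat (f := fun m : ℕ =>
    (⟨min m n, Nat.lt_succ_of_le (min_le_right _ _)⟩ : Fin (n + 1)))).comp h

theorem cell_eq {n : ℕ} {i : Fin (n + 1)} {x : ℝ}
    (hx : x ∈ Set.Ico ((i : ℝ) / (n + 1)) ((i + 1 : ℝ) / (n + 1))) : cell n x = i := by
  have hn : (0 : ℝ) < n + 1 := by positivity
  have h1 : (i : ℝ) ≤ (n + 1) * x := by
    have := (div_le_iff₀ hn).1 hx.1
    linarith
  have h2 : (n + 1) * x < i + 1 := by
    have := (lt_div_iff₀ hn).1 hx.2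
    linarith
  have h3 : ⌊(n + 1 : ℝ) * x⌋₊ = i :=
    (Nat.floor_eq_iff ((Nat.cast_nonneg _).trans h1)).2 ⟨h1, h2⟩
  refine Fin.ext ?_
  simp only [cell, h3]
  exact min_eq_left (Nat.le_of_lt_succ i.2)

theorem unif_Ico_cell {n : ℕ} (i : Fin (n + 1)) :
    unif (Set.Ico ((i : ℝ) / (n + 1)) ((i + 1 : ℝ) / (n + 1))) = ENNReal.ofReal (1 / (n + 1)) := by
  have hn : (0 : ℝ) < n + 1 := by positivity
  have hi : (i : ℝ) + 1 ≤ n + 1 := by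
    have : (i : ℕ) + 1 ≤ n + 1 := i.2
    exact_mod_cast this
  rw [unif, Measure.restrict_apply measurableSet_Ico, Set.inter_eq_left.2, Real.volume_Ico]
  · congr 1
    field_simp
    ring
  · refine fun x hx => ⟨le_trans (by positivity) hx.1, hx.2.le.trans ?_⟩
    rw [div_le_one hn]
    exact hi

/-- If the `i`-th sample point lies in the cell `j (σ i)`, with `j` increasing, then the induced
order statistics are the subword selected by `j`. -/
theorem ios_cell_eq {A : Type*} {n k : ℕ} (w : Fin (n + 1) → A) (σ : Equiv.Perm (Fin k))
    (j : Fin k ↪o Fin (n + 1)) {x : Fin k → ℝ}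
    (hx : ∀ i, x i ∈ Set.Ico ((j (σ i) : ℝ) / (n + 1)) ((j (σ i) + 1 : ℝ) / (n + 1))) :
    ios (fun i => w (cell n (x i))) x = fun i => w (j i) := by
  have hn : (0 : ℝ) < n + 1 := by positivity
  have hs : Tuple.sort x = σ⁻¹ := by
    refine sort_eq_of_strictMono fun a b hab => ?_
    have ha := (hx (σ⁻¹ a)).2
    have hb := (hx (σ⁻¹ b)).1
    rw [show σ (σ⁻¹ a) = a by simp] at ha
    rw [show σ (σ⁻¹ b) = b by simp] at hb
    refine ha.trans_le (le_trans ?_ hb)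
    have : (j a : ℕ) + 1 ≤ j b := j.strictMono hab
    gcongr
    exact_mod_cast this
  ext i
  simp [ios, hs, cell_eq (hx _)]

variable {A : Type*} [MeasurableSpace A]

/-- The law of `(w_i, X)`, where `X` is uniform on `[0, 1]` and `i` is the index of the interval of
length `1 / (n + 1)` that contains `X`. -/
noncomputable def wordLaw {n : ℕ} (w : Word A (n + 1)) : ProbabilityMeasure (A × ℝ) :=
  ⟨unif.map fun x => (w (cell n x), x), Measure.isProbabilityMeasure_map
    (((measurable_from_top (f := w)).comp (measurable_cell n)).prodMk measurable_id).aemeasurable⟩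

theorem measurable_wordPoint {n : ℕ} (w : Word A (n + 1)) :
    Measurable fun x => (w (cell n x), x) :=
  ((measurable_from_top (f := w)).comp (measurable_cell n)).prodMk measurable_id

theorem wordLaw_mem_C {n : ℕ} (w : Word A (n + 1)) : wordLaw w ∈ C A := by
  rw [mem_C_iff_map_snd]
  change (unif.map fun x => (w (cell n x), x)).map Prod.snd = unif
  rw [Measure.map_map measurable_snd (measurable_wordPoint w)]
  exact Measure.map_id

theorem measurable_wordLaw (n : ℕ) :
    Measurable fun w : Word A (n + 1) => (⟨wordLaw w, wordLaw_mem_C w⟩ : C A) := by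
  refine Measurable.subtype_mk (Measurable.subtype_mk
    (f := fun w : Word A (n + 1) => unif.map fun x => (w (cell n x), x)) ?_)
  refine Measure.measurable_of_measurable_coe _ fun B hB => ?_
  have he : Measurable (fun q : Word A (n + 1) × Fin (n + 1) => q.1 q.2) :=
    measurable_from_prod_countable_left fun i => measurable_pi_apply i
  have hj : Measurable fun q : Word A (n + 1) × ℝ => (q.1 (cell n q.2), q.2) :=
    (he.comp (measurable_fst.prodMk ((measurable_cell n).comp measurable_snd))).prodMk
      measurable_snd
  have h := measurable_measure_prodMk_left (ν := unif) (hj hB)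
  have he : (fun w : Word A (n + 1) => (unif.map fun x => (w (cell n x), x)) B) =
      fun w => unif (Prod.mk w ⁻¹' ((fun q : Word A (n + 1) × ℝ => (q.1 (cell n q.2), q.2)) ⁻¹' B)) :=
    funext fun w => Measure.map_apply (measurable_wordPoint w) hB
  rw [he]
  exact h

theorem spread_wordLaw_apply {n : ℕ} (w : Word A (n + 1)) (k : ℕ) {B : Set (Word A k)}
    (hB : MeasurableSet B) :
    (spread (wordLaw w) k : Measure (Word A k)) B =
      (Measure.pi fun _ : Fin k => unif) {x | ios (fun i => w (cell n (x i))) x ∈ B} := by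
  change ((Measure.pi fun _ : Fin k => unif.map fun x => (w (cell n x), x)).map _) B = _
  have hm := measurable_wordPoint w
  have : ∀ _ : Fin k, IsProbabilityMeasure (unif.map fun x => (w (cell n x), x)) :=
    fun _ => Measure.isProbabilityMeasure_map hm.aemeasurable
  have hm' : Measurable fun (x : Fin k → ℝ) (i : Fin k) => (w (cell n (x i)), x i) :=
    measurable_pi_lambda _ fun i => hm.comp (measurable_pi_apply i)
  rw [← Measure.pi_map_pi fun _ => hm.aemeasurable, Measure.map_map (measurable_ios k) hm',
    Measure.map_apply ((measurable_ios k).comp hm') hB]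
  rfl

/-- A pair `(σ, j)` prescribes distinct cells for the `k` sample points, and on that box the sorted
word is the subword along `j`. The boxes are disjoint with mass `(1 / (n + 1)) ^ k`, and each `j`
has `k!` of them. Samples with two points in one cell are discarded, hence only an inequality. -/
theorem sum_indicator_le_spread_wordLaw {n : ℕ} (w : Word A (n + 1)) (k : ℕ) {B : Set (Word A k)}
    (hB : MeasurableSet B) :
    (k.factorial : ℝ≥0∞) * ENNReal.ofReal (1 / (n + 1)) ^ k *
        ∑ j : Fin k ↪o Fin (n + 1), B.indicator 1 (fun i => w (j i)) ≤
      (spread (wordLaw w) k : Measure (Word A k)) B := by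
  classical
  set c : Fin (n + 1) → Set ℝ := fun i => Set.Ico ((i : ℝ) / (n + 1)) ((i + 1 : ℝ) / (n + 1))
    with hc
  set Q : Equiv.Perm (Fin k) × (Fin k ↪o Fin (n + 1)) → Set (Fin k → ℝ) :=
    fun q => Set.univ.pi fun i => c (q.2 (q.1 i)) with hQ
  set T : Finset (Equiv.Perm (Fin k) × (Fin k ↪o Fin (n + 1))) :=
    Finset.univ.filter fun q => (fun i => w (q.2 i)) ∈ B with hT
  have hdisj : Set.PairwiseDisjoint (T : Set _) Q := by
    rintro ⟨σ, j⟩ - ⟨σ', j'⟩ - hne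
    refine Set.disjoint_left.2 fun x hx hx' => hne ?_
    have he : ∀ i, j (σ i) = j' (σ' i) := fun i => by
      rw [← cell_eq (hx i trivial), ← cell_eq (hx' i trivial)]
    have hj : j = j' := by
      refine OrderEmbedding.range_inj.1 ?_
      rw [← σ.surjective.range_comp j, ← σ'.surjective.range_comp j']
      exact congrArg Set.range (funext he)
    subst hj
    exact Prod.ext (Equiv.ext fun i => j.injective (he i)) rfl
  have hQm : ∀ q ∈ T, MeasurableSet (Q q) :=
    fun q _ => MeasurableSet.univ_pi fun i => measurableSet_Ico
  have hQv : ∀ q, (Measure.pi fun _ : Fin k => unif) (Q q) = ENNReal.ofReal (1 / (n + 1)) ^ k :=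
    fun q => by
      rw [hQ, Measure.pi_pi]
      simp only [hc, unif_Ico_cell, Finset.prod_const, Finset.card_univ, Fintype.card_fin]
  calc (k.factorial : ℝ≥0∞) * ENNReal.ofReal (1 / (n + 1)) ^ k *
        ∑ j : Fin k ↪o Fin (n + 1), B.indicator 1 (fun i => w (j i))
      = ∑ q ∈ T, (Measure.pi fun _ : Fin k => unif) (Q q) := by
        have h : ∀ j : Fin k ↪o Fin (n + 1),
            (∑ σ : Equiv.Perm (Fin k), if (fun i => w (j i)) ∈ B then
              (Measure.pi fun _ : Fin k => unif) (Q (σ, j)) else 0) =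
            (k.factorial : ℝ≥0∞) * ENNReal.ofReal (1 / (n + 1)) ^ k *
              B.indicator 1 (fun i => w (j i)) := fun j => by
          simp only [hQv, Finset.sum_const, Finset.card_univ, Fintype.card_perm, Fintype.card_fin,
            nsmul_eq_mul, Set.indicator_apply]
          split_ifs <;> simp
        rw [hT, Finset.sum_filter, Fintype.sum_prod_type_right, Finset.mul_sum]
        exact Finset.sum_congr rfl fun j _ => (h j).symm
    _ = (Measure.pi fun _ : Fin k => unif) (⋃ q ∈ T, Q q) :=
        (measure_biUnion_finset hdisj hQm).symm
    _ ≤ _ := by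
        rw [spread_wordLaw_apply w k hB]
        refine measure_mono (Set.iUnion₂_subset fun q hq x hx => ?_)
        have h := ios_cell_eq w q.1 q.2 (x := x) fun i => hx i trivial
        simp only [Set.mem_ofPred_eq, h]
        exact (Finset.mem_filter.1 hq).2

theorem mul_rss_le_spread_wordLaw {n k : ℕ} (hk : k ≤ n + 1) (w : Word A (n + 1))
    {B : Set (Word A k)} (hB : MeasurableSet B) :
    ENNReal.ofReal ((1 - k / (n + 1)) ^ k) * rss w k B ≤
      (spread (wordLaw w) k : Measure (Word A k)) B := by
  refine le_trans ?_ (sum_indicator_le_spread_wordLaw w k hB)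
  rw [rss_apply w k hB, ← mul_assoc]
  refine mul_le_mul_left ?_ _
  have hn : (0 : ℝ) < n + 1 := by positivity
  rw [← div_eq_mul_inv]
  refine ENNReal.div_le_of_le_mul ?_
  -- The product is the falling factorial of `n + 1`, whose `k` factors are all at least `n + 2 -
  -- k`; the weaker `n + 1 - k` makes the ratio exactly `1 - k / (n + 1)`.
  have h1 : ((n + 1 - k : ℕ) : ℝ) ^ k ≤ (k.factorial * (n + 1).choose k : ℕ) := by
    rw [← Nat.descFactorial_eq_factorial_mul_choose]
    have h := Nat.pow_sub_le_descFactorial (n + 1) k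
    have h' : (n + 1 - k) ^ k ≤ (n + 1 + 1 - k) ^ k := Nat.pow_le_pow_left (by omega) k
    exact_mod_cast h'.trans h
  have h2 : ((1 : ℝ) - k / (n + 1)) = ((n + 1 - k : ℕ) : ℝ) / (n + 1) := by
    rw [Nat.cast_sub hk]
    push_cast
    field_simp
  rw [← ENNReal.ofReal_pow (by positivity), ← ENNReal.ofReal_natCast, ← ENNReal.ofReal_natCast,
    ← ENNReal.ofReal_mul (by positivity), ← ENNReal.ofReal_mul (by positivity), h2, div_pow,
    one_div, inv_pow, div_eq_mul_inv]
  refine ENNReal.ofReal_le_ofReal ?_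
  push_cast at h1 ⊢
  calc ((n + 1 - k : ℕ) : ℝ) ^ k * ((n + 1 : ℝ) ^ k)⁻¹
      ≤ ((k.factorial : ℝ) * (n + 1).choose k) * ((n + 1 : ℝ) ^ k)⁻¹ := by gcongr
    _ = _ := by ring

/-- The law of `wordLaw w` for a random word `w`. -/
noncomputable def empiricalMixture {n : ℕ} (ν : ProbabilityMeasure (Word A (n + 1))) :
    ProbabilityMeasure (C A) :=
  ν.map (measurable_wordLaw n).aemeasurable

theorem le_spreadMixture_empiricalMixture {n k : ℕ} (hk : k ≤ n + 1)
    (ν : ProbabilityMeasure (Word A (n + 1))) {B : Set (Word A k)} (hB : MeasurableSet B) :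
    ENNReal.ofReal ((1 - k / (n + 1)) ^ k) *
        (ν : Measure (Word A (n + 1))).bind (fun w => rss w k) B ≤
      (spreadMixture (empiricalMixture ν) k : Measure (Word A k)) B := by
  rw [bind_rss_apply _ _ hB, spreadMixture_apply _ _ hB, empiricalMixture,
    ProbabilityMeasure.toMeasure_map, lintegral_map
    (f := fun ρ : C A => (spread (ρ : ProbabilityMeasure (A × ℝ)) k : Measure (Word A k)) B)
    ((Measure.measurable_coe hB).comp ((measurable_spread k).comp measurable_subtype_coe))
    (measurable_wordLaw n), ← lintegral_const_mul' _ _ ENNReal.ofReal_ne_top]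
  exact lintegral_mono fun w => mul_rss_le_spread_wordLaw hk w hB

variable [TopologicalSpace A] [CompactSpace A] [TopologicalSpace.MetrizableSpace A] [BorelSpace A]

/-- Integrating `f` against the mixture amounts to integrating the continuous function `ρ ↦ ∫ f
d(spread ρ k)` against `α`. -/
theorem continuous_spreadMixture (k : ℕ) :
    Continuous fun α : ProbabilityMeasure (C A) => spreadMixture α k := by
  have := secondCountable_of_compact_metrizable A
  rw [ProbabilityMeasure.continuous_iff_forall_continuous_lintegral]
  intro f
  let F : C(C A, ℝ≥0) :=
    ⟨fun ρ => (spread (ρ : ProbabilityMeasure (A × ℝ)) k).toFiniteMeasure.testAgainstNN f,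
      (ProbabilityMeasure.continuous_testAgainstNN_eval f).comp (continuous_spread k)⟩
  have hF : ∀ α : ProbabilityMeasure (C A),
      ∫⁻ w, (f w : ℝ≥0∞) ∂(spreadMixture α k : Measure (Word A k)) =
        ∫⁻ ρ, (BoundedContinuousFunction.mkOfCompact F ρ : ℝ≥0∞) ∂(α : Measure (C A)) := by
    intro α
    change ∫⁻ w, (f w : ℝ≥0∞) ∂((α : Measure (C A)).bind _) = _
    have hs : Measurable fun ρ : C A =>
        (spread (ρ : ProbabilityMeasure (A × ℝ)) k : Measure (Word A k)) :=
      (measurable_spread k).comp measurable_subtype_coe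
    have hf : Measurable fun w : Word A k => (f w : ℝ≥0∞) := by fun_prop
    rw [Measure.lintegral_bind hs.aemeasurable hf.aemeasurable]
    refine lintegral_congr fun ρ => ?_
    exact (FiniteMeasure.testAgainstNN_coe_eq (f := f)
      (μ := (spread (ρ : ProbabilityMeasure (A × ℝ)) k).toFiniteMeasure)).symm
  simp only [hF]
  exact ProbabilityMeasure.continuous_lintegral_boundedContinuousFunction _

theorem exists_spreadMixture_eq {μ : (k : ℕ+) → ProbabilityMeasure (Word A k)}
    (hμ : IsConsistent μ) :
    ∃ α : ProbabilityMeasure (C A), ∀ k : ℕ+, μ k = spreadMixture α k := by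
  have := secondCountable_of_compact_metrizable A
  let a : ℕ → ProbabilityMeasure (C A) := fun n => empiricalMixture (n := n) (μ n.succPNat)
  -- Compactness of the space of mixing measures gives a limit along an ultrafilter; one `α` serves
  -- all `k`, and no subsequence is needed.
  obtain ⟨α, -, hα⟩ := isCompact_univ.ultrafilter_le_nhds ((hyperfilter ℕ).map a) (by simp)
  have hlim : Tendsto a (hyperfilter ℕ : Filter ℕ) (𝓝 α) := hα
  refine ⟨α, fun k => ?_⟩
  have hmix := ((continuous_spreadMixture (A := A) k).tendsto α).comp hlim
  have hle : ∀ F : Set (Word A k), IsClosed F →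
      (μ k : Measure (Word A k)) F ≤ (spreadMixture α k : Measure (Word A k)) F := by
    intro F hF
    refine le_trans ?_ (ProbabilityMeasure.limsup_measure_closed_le_of_tendsto hmix hF)
    have hq : Tendsto (fun n : ℕ => ENNReal.ofReal ((1 - (k : ℕ) / (n + 1)) ^ (k : ℕ)) *
        (μ k : Measure (Word A k)) F) atTop (𝓝 ((μ k : Measure (Word A k)) F)) := by
      have h1 : Tendsto (fun n : ℕ => ((1 : ℝ) - (k : ℕ) * (1 / ((n : ℝ) + 1))) ^ (k : ℕ)) atTop
          (𝓝 ((1 - (k : ℕ) * 0) ^ (k : ℕ))) :=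
        ((tendsto_one_div_add_atTop_nhds_zero_nat.const_mul _).const_sub _).pow _
      have h2 := ENNReal.Tendsto.mul_const (ENNReal.tendsto_ofReal h1)
        (b := (μ k : Measure (Word A k)) F) (Or.inr (measure_ne_top _ _))
      simpa [div_eq_mul_inv] using h2
    rw [← (hq.mono_left Nat.hyperfilter_le_atTop).limsup_eq]
    refine limsup_le_limsup ?_
    filter_upwards [Nat.hyperfilter_le_atTop (eventually_ge_atTop (k : ℕ))] with n hn
    have hkn : (k : ℕ) ≤ n + 1 := Nat.le_succ_of_le hn
    have hc := hμ k n.succPNat hkn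
    have h := le_spreadMixture_empiricalMixture hkn (μ n.succPNat) hF.measurableSet
    rw [hc]
    exact h
  -- Domination on closed sets is the portmanteau criterion for the constant sequence `μ k` to
  -- converge to the mixture; limits are unique, so the one-sided bound suffices.
  have hconst : Tendsto (fun _ : ℕ => μ k) atTop (𝓝 (spreadMixture α k)) :=
    tendsto_of_forall_isClosed_limsup_le' fun F hF => by
      rw [limsup_const]
      exact hle F hF
  exact tendsto_nhds_unique tendsto_const_nhds hconst

end Existence

/-! ### Uniqueness of the mixing measure -/

section Uniqueness

/-- Finite measures on a compact metrizable space that agree on a multiplicative, point-separating family of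
bounded continuous functions are equal. -/
theorem ext_of_forall_mem_submonoid_integral_eq {E : Type*} [TopologicalSpace E] [CompactSpace E]
    [TopologicalSpace.MetrizableSpace E] [MeasurableSpace E] [BorelSpace E] {P P' : Measure E} [IsFiniteMeasure P] [IsFiniteMeasure P']
    (M : Submonoid (E →ᵇ ℝ)) (hM : ∀ a b : E, a ≠ b → ∃ g ∈ M, g a ≠ g b)
    (heq : ∀ g ∈ M, ∫ z, g z ∂P = ∫ z, g z ∂P') : P = P' := by
  have : PolishSpace E := by
    let := TopologicalSpace.metrizableSpaceMetric E
    infer_instance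
  let 𝓐 : StarSubalgebra ℝ (E →ᵇ ℝ) :=
    { Algebra.adjoin ℝ (M : Set (E →ᵇ ℝ)) with
      star_mem' := fun {g} hg => by
        have : star g = g := by ext z; simp
        rw [this]
        exact hg }
  refine ext_of_forall_mem_subalgebra_integral_eq_of_polish (𝕜 := ℝ) (A := 𝓐) ?_ ?_
  · intro a b hab
    obtain ⟨g, hg, hne⟩ := hM a b hab
    exact ⟨g, ⟨g.toContinuousMap, ⟨g, Algebra.subset_adjoin hg, rfl⟩, rfl⟩, hne⟩
  · intro g hg
    -- As `M` is closed under products, the algebra it generates is its linear span, so linearity of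
    -- the integral suffices.
    have hg' : g ∈ Submodule.span ℝ (M : Set (E →ᵇ ℝ)) := by
      have h : g ∈ Subalgebra.toSubmodule (Algebra.adjoin ℝ (M : Set (E →ᵇ ℝ))) := hg
      rwa [Algebra.adjoin_eq_span, Submonoid.closure_eq] at h
    clear hg
    induction hg' using Submodule.span_induction with
    | mem g hg => exact heq g hg
    | zero => simp
    | add g₁ g₂ _ _ h₁ h₂ =>
      simp only [BoundedContinuousFunction.coe_add, Pi.add_apply]
      rw [integral_add (g₁.integrable P) (g₂.integrable P),
        integral_add (g₁.integrable P') (g₂.integrable P'), h₁, h₂]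
    | smul c g _ h =>
      simp only [BoundedContinuousFunction.coe_smul, smul_eq_mul]
      rw [integral_const_mul, integral_const_mul, h]

/-- The functions `(y, x) ↦ f y * x ^ m` on `A × [0, 1]`, with `f` continuous and nonnegative. -/
def monomials (A : Type*) [TopologicalSpace A] : Submonoid ((A × unitInterval) →ᵇ ℝ) where
  carrier := {u | ∃ (f : C(A, ℝ)) (m : ℕ), 0 ≤ f ∧ ∀ z, u z = f z.1 * (z.2 : ℝ) ^ m}
  one_mem' := ⟨1, 0, zero_le_one, fun z => by simp⟩
  mul_mem' := by
    rintro u v ⟨f, m, hf, hu⟩ ⟨g, l, hg, hv⟩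
    refine ⟨f * g, m + l, mul_nonneg hf hg, fun z => ?_⟩
    simp only [BoundedContinuousFunction.coe_mul, Pi.mul_apply, hu, hv, ContinuousMap.coe_mul]
    ring

/-- Restriction of the second coordinate to the unit interval. -/
noncomputable def clip (A : Type*) [TopologicalSpace A] : C(A × ℝ, A × unitInterval) :=
  ⟨fun z => (z.1, Set.projIcc 0 1 zero_le_one z.2), by fun_prop⟩

/-- The order-invariant functional `f(y₀) 1{x₁, …, x_m ≤ x₀}`. -/
noncomputable def maxFunctional {A : Type*} (f : A → ℝ) (m : ℕ) (p : Fin (1 + m) → A × ℝ) :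
    ℝ≥0∞ :=
  ENNReal.ofReal (f (p (Fin.castAdd m 0)).1) *
    Set.indicator {p : Fin (1 + m) → A × ℝ |
      ∀ i, (p (Fin.natAdd 1 i)).2 ≤ (p (Fin.castAdd m 0)).2} 1 p

theorem orderInvariant_maxFunctional {A : Type*} (f : A → ℝ) (m : ℕ) :
    OrderInvariant (maxFunctional f m) := by
  intro y x x' _ _ h
  have h' : ∀ i j, x i ≤ x j ↔ x' i ≤ x' j := fun i j => by
    rw [← not_lt, ← not_lt, h j i]
  simp only [maxFunctional, Set.indicator_apply, Set.mem_ofPred_eq, h', Pi.one_apply]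

variable {A : Type*} [MeasurableSpace A]

theorem measurable_maxFunctional {f : A → ℝ} (hf : Measurable f) (m : ℕ) :
    Measurable (maxFunctional f m) := by
  have hS : MeasurableSet {p : Fin (1 + m) → A × ℝ |
      ∀ i, (p (Fin.natAdd 1 i)).2 ≤ (p (Fin.castAdd m 0)).2} := by
    simp only [Set.ofPred_forall]
    exact MeasurableSet.iInter fun i => measurableSet_le (by fun_prop) (by fun_prop)
  unfold maxFunctional
  exact Measurable.mul (by fun_prop) (measurable_one.indicator hS)

theorem measure_snd_le {ρ : ProbabilityMeasure (A × ℝ)} (hρ : ρ ∈ C A) {t : ℝ}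
    (ht : t ∈ Set.Icc (0 : ℝ) 1) :
    (ρ : Measure (A × ℝ)) {z | z.2 ≤ t} = ENNReal.ofReal t := by
  rw [← hρ t ht]
  refine measure_congr ?_
  filter_upwards [ae_snd_mem_Icc hρ] with z hz
  refine propext ?_
  change z.2 ≤ t ↔ True ∧ 0 ≤ z.2 ∧ z.2 ≤ t
  simp [hz.1]

/-- Given the first point `z`, each of the `m` others independently has label at most `z.2` with
probability `z.2`. -/
theorem lintegral_maxFunctional {ρ : ProbabilityMeasure (A × ℝ)} (hρ : ρ ∈ C A) {f : A → ℝ}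
    (hf : Measurable f) (m : ℕ) :
    ∫⁻ p, maxFunctional f m p ∂(Measure.pi fun _ : Fin (1 + m) => (ρ : Measure (A × ℝ))) =
      ∫⁻ z, ENNReal.ofReal (f z.1) * ENNReal.ofReal z.2 ^ m ∂(ρ : Measure (A × ℝ)) := by
  have hin : ∀ z : A × ℝ, ∫⁻ b, ENNReal.ofReal (f z.1) *
      Set.indicator (Set.univ.pi fun _ : Fin m => {z' : A × ℝ | z'.2 ≤ z.2}) 1 b
        ∂(Measure.pi fun _ : Fin m => (ρ : Measure (A × ℝ))) =
      ENNReal.ofReal (f z.1) * (ρ : Measure (A × ℝ)) {z' | z'.2 ≤ z.2} ^ m := fun z => by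
    have hm : MeasurableSet {z' : A × ℝ | z'.2 ≤ z.2} :=
      measurableSet_le measurable_snd measurable_const
    rw [lintegral_const_mul' _ _ ENNReal.ofReal_ne_top,
      lintegral_indicator_one (MeasurableSet.univ_pi fun _ => hm), Measure.pi_pi]
    simp
  have hF : Measurable fun z : A × ℝ =>
      ENNReal.ofReal (f z.1) * (ρ : Measure (A × ℝ)) {z' | z'.2 ≤ z.2} ^ m := by
    have h : Measurable fun z : A × ℝ => (ρ : Measure (A × ℝ)) {z' | z'.2 ≤ z.2} :=
      measurable_measure_prodMk_left (ν := (ρ : Measure (A × ℝ)))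
        (s := {q : (A × ℝ) × (A × ℝ) | q.2.2 ≤ q.1.2})
        (measurableSet_le (by fun_prop) (by fun_prop))
    exact Measurable.mul (by fun_prop) (h.pow_const m)
  have happ : ∀ (a : Fin 1 → A × ℝ) (b : Fin m → A × ℝ), maxFunctional f m (Fin.append a b) =
      ENNReal.ofReal (f (a 0).1) *
        Set.indicator (Set.univ.pi fun _ : Fin m => {z' : A × ℝ | z'.2 ≤ (a 0).2}) 1 b := by
    classical
    intro a b
    simp only [maxFunctional, Set.indicator_apply, Set.mem_ofPred_eq, Fin.append_left,
      Fin.append_right, Set.mem_univ_pi, Pi.one_apply]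
  rw [lintegral_pi_append _ 1 m (measurable_maxFunctional hf m)]
  simp only [happ, hin]
  rw [(measurePreserving_eval (fun _ : Fin 1 => (ρ : Measure (A × ℝ))) 0).lintegral_comp hF]
  refine lintegral_congr_ae ?_
  filter_upwards [ae_snd_mem_Icc hρ] with z hz
  rw [measure_snd_le hρ hz]

variable [TopologicalSpace A] [CompactSpace A] [TopologicalSpace.MetrizableSpace A] [BorelSpace A]

/-- Clipping moves `ρ` to the compact space `A × [0, 1]`, where the monomials separate points; it
loses nothing, since the labels lie in `[0, 1]` almost surely. -/
theorem eq_of_integral_clip_eq {ρ ρ' : ProbabilityMeasure (A × ℝ)} (hρ : ρ ∈ C A) (hρ' : ρ' ∈ C A)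
    (h : ∀ u ∈ monomials A, ∫ z, u (clip A z) ∂(ρ : Measure (A × ℝ)) =
      ∫ z, u (clip A z) ∂(ρ' : Measure (A × ℝ))) : ρ = ρ' := by
  have := secondCountable_of_compact_metrizable A
  have hc : Measurable (clip A) := (clip A).continuous.measurable
  have hmap : (ρ : Measure (A × ℝ)).map (clip A) = (ρ' : Measure (A × ℝ)).map (clip A) := by
    have : IsProbabilityMeasure ((ρ : Measure (A × ℝ)).map (clip A)) :=
      Measure.isProbabilityMeasure_map hc.aemeasurable
    have : IsProbabilityMeasure ((ρ' : Measure (A × ℝ)).map (clip A)) :=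
      Measure.isProbabilityMeasure_map hc.aemeasurable
    refine ext_of_forall_mem_submonoid_integral_eq (monomials A) ?_ fun u hu => ?_
    · rintro ⟨a, s⟩ ⟨b, t⟩ hne
      by_cases hst : s = t
      · have hab : a ≠ b := fun hab => hne (by rw [hab, hst])
        let := TopologicalSpace.metrizableSpaceMetric A
        -- Different letters are separated by the distance to `a` (exponent 0), different labels by
        -- the label itself (`f = 1`, exponent 1).
        refine ⟨BoundedContinuousFunction.mkOfCompact ⟨fun z => dist z.1 a, by fun_prop⟩,
          ⟨⟨fun y => dist y a, by fun_prop⟩, 0, fun y => dist_nonneg, fun z => by simp⟩, ?_⟩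
        simpa using (dist_pos.2 hab.symm).ne
      · refine ⟨BoundedContinuousFunction.mkOfCompact ⟨fun z => (z.2 : ℝ), by fun_prop⟩,
          ⟨1, 1, zero_le_one, fun z => by simp⟩, ?_⟩
        simpa [Subtype.ext_iff] using hst
    · rw [integral_map hc.aemeasurable (by fun_prop), integral_map hc.aemeasurable (by fun_prop)]
      exact h u hu
  have hback : ∀ ρ : ProbabilityMeasure (A × ℝ), ρ ∈ C A →
      ((ρ : Measure (A × ℝ)).map (clip A)).map (fun z => (z.1, (z.2 : ℝ))) = ρ := fun ρ hρ => by
    rw [Measure.map_map (by fun_prop) hc]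
    conv_rhs => rw [← Measure.map_id (μ := (ρ : Measure (A × ℝ)))]
    refine Measure.map_congr ?_
    filter_upwards [ae_snd_mem_Icc hρ] with z hz
    refine Prod.ext rfl ?_
    simp [clip, Set.projIcc_of_mem zero_le_one hz]
  refine ProbabilityMeasure.toMeasure_injective ?_
  rw [← hback ρ hρ, ← hback ρ' hρ', hmap]

/-- The nonnegative continuous functions on `C(A)` that are expectations of an order-invariant
functional of a sample from `ρ`. -/
def sampleFunctions (A : Type*) [MeasurableSpace A] [TopologicalSpace A] [CompactSpace A]
    [TopologicalSpace.MetrizableSpace A] [BorelSpace A] : Submonoid (C A →ᵇ ℝ) where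
  carrier := {φ | ∃ (k : ℕ) (_ : 0 < k) (h : (Fin k → A × ℝ) → ℝ≥0∞), OrderInvariant h ∧
    Measurable h ∧ ∀ ρ : C A, 0 ≤ φ ρ ∧ ENNReal.ofReal (φ ρ) =
      ∫⁻ p, h p ∂(Measure.pi fun _ : Fin k => ((ρ : ProbabilityMeasure (A × ℝ)) :
        Measure (A × ℝ)))}
  -- The constant 1 is given sample size 1, because the mixtures are compared only at positive `k`.
  one_mem' := ⟨1, one_pos, fun _ => 1, fun _ _ _ _ _ _ => rfl, measurable_const, fun ρ => by simp⟩
  mul_mem' := by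
    rintro φ ψ ⟨k, hk, h₁, H₁, hm₁, hφ⟩ ⟨l, hl, h₂, H₂, hm₂, hψ⟩
    refine ⟨k + l, by omega, _, H₁.append H₂, by fun_prop, fun ρ => ?_⟩
    refine ⟨mul_nonneg (hφ ρ).1 (hψ ρ).1, ?_⟩
    rw [lintegral_pi_mul_append _ hm₁ hm₂, ← (hφ ρ).2, ← (hψ ρ).2]
    exact ENNReal.ofReal_mul (hφ ρ).1

/-- The functional is `maxFunctional f m`; nonnegativity of `f` is what makes its `ℝ≥0∞`-valued
expectation the real integral. -/
theorem exists_sampleFunction_eq {u : (A × unitInterval) →ᵇ ℝ} (hu : u ∈ monomials A) :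
    ∃ φ ∈ sampleFunctions A, ∀ ρ : C A,
      φ ρ = ∫ z, u (clip A z) ∂((ρ : ProbabilityMeasure (A × ℝ)) : Measure (A × ℝ)) := by
  have := secondCountable_of_compact_metrizable A
  obtain ⟨f, m, hf, hu⟩ := hu
  have hnn : ∀ z, 0 ≤ u (clip A z) := fun z => by
    rw [hu]
    exact mul_nonneg (hf _) (pow_nonneg (clip A z).2.2.1 m)
  have hcont : Continuous fun ρ : C A =>
      ∫ z, u (clip A z) ∂((ρ : ProbabilityMeasure (A × ℝ)) : Measure (A × ℝ)) :=
    (ProbabilityMeasure.continuous_integral_boundedContinuousFunction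
      (u.compContinuous (clip A))).comp continuous_subtype_val
  refine ⟨BoundedContinuousFunction.mkOfCompact ⟨_, hcont⟩, ⟨1 + m, by omega, maxFunctional f m,
    orderInvariant_maxFunctional f m, measurable_maxFunctional f.continuous.measurable m,
    fun ρ => ⟨integral_nonneg hnn, ?_⟩⟩, fun ρ => rfl⟩
  rw [lintegral_maxFunctional ρ.2 f.continuous.measurable]
  change ENNReal.ofReal (∫ z, u (clip A z) ∂_) = _
  rw [ofReal_integral_eq_lintegral_ofReal (f := fun z => u (clip A z))
    ((u.compContinuous (clip A)).integrable _)
    (Eventually.of_forall hnn)]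
  refine lintegral_congr_ae ?_
  filter_upwards [ae_snd_mem_Icc ρ.2] with z hz
  have hz2 : ((clip A z).2 : ℝ) = z.2 := by simp [clip, Set.projIcc_of_mem zero_le_one hz]
  have hz1 : (clip A z).1 = z.1 := rfl
  have hfz : 0 ≤ f z.1 := hf z.1
  rw [hu, hz1, hz2, ENNReal.ofReal_mul hfz, ENNReal.ofReal_pow hz.1]

theorem spreadMixture_injective {α β : ProbabilityMeasure (C A)}
    (h : ∀ k : ℕ+, spreadMixture α k = spreadMixture β k) : α = β := by
  have := secondCountable_of_compact_metrizable A
  refine ProbabilityMeasure.toMeasure_injective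
    (ext_of_forall_mem_submonoid_integral_eq (sampleFunctions A) ?_ ?_)
  · intro ρ ρ' hne
    by_contra! hcon
    -- If no sample function separated `ρ` from `ρ'`, all their monomial integrals would agree.
    refine hne (Subtype.ext (eq_of_integral_clip_eq ρ.2 ρ'.2 fun u hu => ?_))
    obtain ⟨φ, hφ, hφ'⟩ := exists_sampleFunction_eq hu
    rw [← hφ', ← hφ', hcon φ hφ]
  · rintro φ ⟨k, hk, g, G, hg, hφ⟩
    have key : ∀ γ : ProbabilityMeasure (C A), ∫ ρ, φ ρ ∂(γ : Measure (C A)) =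
        (∫⁻ w, ((k.factorial : ℕ) : ℝ≥0∞)⁻¹ * ∑ σ, g (unsort σ w)
          ∂(spreadMixture γ k : Measure (Word A k))).toReal := fun γ => by
      rw [← G.lintegral_mixture hg γ,
        integral_eq_lintegral_of_nonneg_ae (Eventually.of_forall fun ρ => (hφ ρ).1) (by fun_prop)]
      congr 1
      exact lintegral_congr fun ρ => (hφ ρ).2
    have hk' : spreadMixture α k = spreadMixture β k := h ⟨k, hk⟩
    rw [key α, key β, hk']

end Uniqueness

end RandomSubsequence

/-! ### The representation theorem -/

theorem mainTheorem6 (A : Type*) [MeasurableSpace A] [StandardBorelSpace A] :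
    (∀ μ : (k : ℕ+) → ProbabilityMeasure (RandomSubsequence.Word A k),
      RandomSubsequence.IsConsistent μ ↔
        ∃ α : ProbabilityMeasure (RandomSubsequence.C A),
          ∀ k : ℕ+, μ k = RandomSubsequence.spreadMixture α k) ∧
    Set.BijOn
      (fun (α : ProbabilityMeasure (RandomSubsequence.C A)) (k : ℕ+) =>
        RandomSubsequence.spreadMixture α k)
      Set.univ
      {μ : (k : ℕ+) → ProbabilityMeasure (RandomSubsequence.Word A k) |
        RandomSubsequence.IsConsistent μ} := by
  -- The statement involves only the σ-field of `A`, so the choice of topology is harmless.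
  obtain ⟨_, _, _, _⟩ := RandomSubsequence.exists_compact_metrizable_topology A
  refine ⟨fun μ => ⟨RandomSubsequence.exists_spreadMixture_eq, ?_⟩, ?_, ?_, ?_⟩
  · rintro ⟨α, hα⟩
    obtain rfl : μ = fun k : ℕ+ => RandomSubsequence.spreadMixture α k := funext hα
    exact RandomSubsequence.isConsistent_spreadMixture α
  · exact fun α _ => RandomSubsequence.isConsistent_spreadMixture α
  · exact fun α _ β _ h => RandomSubsequence.spreadMixture_injective fun k => congrFun h k
  · intro μ hμ
    obtain ⟨α, hα⟩ := RandomSubsequence.exists_spreadMixture_eq hμ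
    exact ⟨α, trivial, (funext hα).symm⟩
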